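/- Let $e\neq 0$, $a>0$. Consider $\mathrm{SU}(2)$ Yang--Mills--Higgs theory on $\mathbb{R}^3$ with $\mathfrak{su}(2)\cong(\mathbb{R}^3,\times)$, with smooth $\mathbb{R}^3$-valued canonical variables $(A_i,\pi^i,\phi,\Pi)$, $i=1,2,3$, in Cartesian coordinates. Put $r=|x|$, $V(\phi)=(\|\phi\|^2-a^2)^2$, $D_if=\partial_if+eA_i\times f$, $F_{ij}=\partial_iA_j-\partial_jA_i+eA_i\times A_j$, $\mathscr G=D_i\pi^i+e\,\phi\times\Pi$. An asymptotic expansion $f\sim\sum_n r^{-n}f^{(n)}$ has coefficients $f^{(n)}\in C^\infty(S^2)$ and may be differentiated term by term; $o(r^{-\mathbb{N}})$ means $o(r^{-n})$ for all $n\in\mathbb{N}$. Let $\mathcal{C}_0$ be the set of all $(A,\pi,\phi,\Pi)$ such that (i) (fall-off) $A_i\sim\sum_{n\ge1}r^{-n}A_i^{(n-1)}$, $\pi^i\sim\sum_{n\ge1}r^{-n-1}\pi^i_{(n-1)}$, $\phi\sim\phi_\infty+\sum_{n\ge1}r^{-n}\phi^{(n)}$, $\Pi\sim\sum_{n\ge2}r^{-n}\Pi^{(n-2)}$;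 (ii) (boundary conditions) $\|\phi_\infty\|^2=a^2$, $\phi_\infty\cdot\phi^{(1)}=0$, $\Pi^{(0)}=\bar\Pi\,\phi_\infty$ for some scalar function $\bar\Pi$, $\tfrac1rA_i^{(0)}=\tfrac1r\bar A_i\phi_\infty-\tfrac1{ea^2}\phi_\infty\times\partial_i\phi_\infty$ for some scalar functions $\bar A_i$, and the coefficient of order $r^{-3}$ of $\mathscr G$ is zero; (iii) (constraint) $\mathscr G=0$ on $\mathbb{R}^3$. For $\xi^\perp=b_ix^i+a^\perp$ and $\xi^i=b^i{}_jx^j+a^i$ with $b_{ij}=-b_{ji}$, and a gauge parameter $\zeta\sim\sum_{n\ge0}r^{-n}\zeta^{(n)}$, the local Poincaré action is $$\begin{aligned} \delta A_i&=\xi^\perp\pi_i+\xi^j\partial_jA_i+(\partial_i\xi^j)A_j-D_i\zeta,\\ \delta\pi^i&=D_j(\xi^\perp F^{ji})-e\,\xi^\perp\phi\times D^i\phi+\partial_j(\xi^j\pi^i)-\pi^j\partial_j\xi^i+e\,\zeta\times\pi^i,\\ \delta\phi&=\xi^\perp\Pi+\xi^i\partial_i\phi+e\,\zeta\times\phi,\\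 \delta\Pi&=D_l(\xi^\perp D^l\phi)-\xi^\perp\,\partial V/\partial\phi+\xi^i\partial_i\Pi+e\,\zeta\times\Pi. \end{aligned}$$ Let $\mathcal{C}\subseteq\mathcal{C}_0$ be any set of states that is invariant under this local action: for every $p\in\mathcal{C}$ and every $(\xi^\perp,\xi^i)$ there is a gauge parameter $\zeta$ as above (which may depend on $p$ and $(\xi^\perp,\xi^i)$) such that $\delta p$ is tangent to $\mathcal{C}$ at $p$. Here tangent means that $\delta p$ satisfies the fall-off conditions (i) and is the velocity at $t=0$ of a curve in $\mathcal{C}$ through $p$, where the fields and the coefficients of their asymptotic expansions are differentiable in $t$ at $t=0$, pointwise and together with all spatial derivatives, and the derivatives of the coefficients are the coefficients of $\delta p$. Then for every $(A,\pi,\phi,\Pi)\in\mathcal{C}$: 1. every coefficient of the asymptotic expansion of $D_i\phi$ vanishes, for $i=1,2,3$; 2. every coefficient of the asymptotic expansion of $\Pi$ vanishes; 3. $A_i=\dfrac{A_i\cdot\phi}{\|\phi\|^2}\,\phi-\dfrac1{e\|\phi\|^2}\,\phi\times\partial_i\phi+o(r^{-\mathbb{N}})$ and $\pi^i=\dfrac{\pi^i\cdot\phi}{\|\phi\|^2}\,\phi+o(r^{-\mathbb{N}})$,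 for $i=1,2,3$. -/

import Mathlib

open Filter Asymptotics Bornology Topology
open scoped ContDiff Matrix

namespace YMH

/-- Space `Σ = ℝ³` with its Euclidean metric; `‖x‖` is the radius `r`. -/
abbrev Space : Type := EuclideanSpace ℝ (Fin 3)

/-- The Lie algebra `su(2) ≅ (ℝ³, ×)`: bracket `⨯₃`, invariant inner product `⬝ᵥ`. -/
abbrev su2 : Type := Fin 3 → ℝ

/-- The Cartesian partial derivative `∂_i`. -/
noncomputable def pd {V : Type*} [NormedAddCommGroup V] [NormedSpace ℝ V]
    (i : Fin 3) (f : Space → V) (x : Space) : V :=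
  fderiv ℝ f x (EuclideanSpace.single i 1)

/-! ### Asymptotic expansions -/

/-- The smooth function `f` on `ℝ³` has the asymptotic expansion `f ∼ ∑_{n ≥ 0} c n`, where
`c n x = r^{-n} f⁽ⁿ⁾(x / r)` with `f⁽ⁿ⁾` a smooth function on the unit sphere; equivalently `c n` is
smooth on `ℝ³ ∖ {0}` and positively homogeneous of degree `-n`. The expansion may be differentiated
term by term. The term `c n`, restricted to `ℝ³ ∖ {0}`, is what the operator `𝒪_{r^{-n}}` picks out
of `f`; the value of `c n` at `0` is irrelevant. -/
structure HasExpansion (f : Space → su2) (c : ℕ → Space → su2) : Prop where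
  smooth : ContDiff ℝ ∞ f
  smooth_coeff : ∀ n, ContDiffOn ℝ ∞ (c n) {0}ᶜ
  homogeneous : ∀ (n : ℕ) (r : ℝ) (x : Space), 0 < r → x ≠ 0 →
    c n (r • x) = (r ^ n)⁻¹ • c n x
  remainder : ∀ N k : ℕ,
    (fun x => iteratedFDeriv ℝ k (fun y => f y - ∑ n ∈ Finset.range N, c n y) x)
      =O[cobounded Space] (fun x => (‖x‖ ^ (N + k))⁻¹)

/-- `f` has an asymptotic expansion in powers of `1/r` all of whose coefficients are zero. -/
def VanishesToAllOrders (f : Space → su2) : Prop :=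
  HasExpansion f (fun _ _ => 0)

/-- `f = o(r^{-ℕ})`: `f` falls off faster than every power `r^{-n}`. -/
def IsFastFalloff (f : Space → su2) : Prop :=
  ∀ n : ℕ, f =o[cobounded Space] (fun x => (‖x‖ ^ n)⁻¹)

/-! ### Canonical variables -/

/-- The canonical variables of `SU(2)` Yang–Mills–Higgs theory on `ℝ³` in Cartesian coordinates
(where `√g = 1`, so that densities are ordinary functions and indices may be moved freely). -/
structure Fields where
  /-- the Yang–Mills field `A_i` -/
  A : Fin 3 → Space → su2
  /-- its momentum `π^i` -/
  mom : Fin 3 → Space → su2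
  /-- the Higgs field `φ` -/
  phi : Space → su2
  /-- its momentum `Π` -/
  phiMom : Space → su2

/-- The covariant derivative `D_i f = ∂_i f + e A_i × f`. -/
noncomputable def covD (e : ℝ) (A : Fin 3 → Space → su2) (i : Fin 3) (f : Space → su2)
    (x : Space) : su2 :=
  pd i f x + e • (A i x ⨯₃ f x)

/-- The curvature `F_ij = ∂_i A_j - ∂_j A_i + e A_i × A_j`. -/
noncomputable def curvature (e : ℝ) (A : Fin 3 → Space → su2) (i j : Fin 3) (x : Space) : su2 :=
  pd i (A j) x - pd j (A i) x + e • (A i x ⨯₃ A j x)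

/-- The Gauss constraint function `𝒢 = D_i π^i + e φ × Π`. -/
noncomputable def gauss (e : ℝ) (p : Fields) (x : Space) : su2 :=
  ∑ i, covD e p.A i (p.mom i) x + e • (p.phi x ⨯₃ p.phiMom x)

/-- The Higgs potential `V(φ) = (‖φ‖² - a²)²`. -/
def potential (a : ℝ) (v : su2) : ℝ := (v ⬝ᵥ v - a ^ 2) ^ 2

/-- The gradient `∂V/∂φ`. -/
noncomputable def gradPotential (a : ℝ) (v : su2) : su2 :=
  fun k => fderiv ℝ (potential a) v (Pi.single k 1)

/-! ### Fall-off conditions, boundary conditions, constraint surface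

The asymptotic expansions of all fields of a state are collected in a sequence `C : ℕ → Fields`,
`C n` being the part of order `r^{-n}`. -/

/-- The fall-off conditions: `φ` has an expansion starting at order `r^0`, the `A_i` at order
`r^{-1}`, the `π^i` and `Π` at order `r^{-2}`; `C` collects the coefficients. -/
structure FallOff (p : Fields) (C : ℕ → Fields) : Prop where
  A : ∀ i, HasExpansion (p.A i) (fun n => (C n).A i)
  A_lead : ∀ i, ∀ n < 1, ∀ x ≠ 0, (C n).A i x = 0
  mom : ∀ i, HasExpansion (p.mom i) (fun n => (C n).mom i)
  mom_lead : ∀ i, ∀ n < 2, ∀ x ≠ 0, (C n).mom i x = 0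
  phi : HasExpansion p.phi (fun n => (C n).phi)
  phiMom : HasExpansion p.phiMom (fun n => (C n).phiMom)
  phiMom_lead : ∀ n < 2, ∀ x ≠ 0, (C n).phiMom x = 0

/-- The boundary conditions on the leading coefficients. With `φ_∞ = (C 0).phi`:
`‖φ_∞‖² = a²`; `φ_∞ · φ⁽¹⁾ = 0`; the leading term of `Π` is parallel to `φ_∞`; the leading term of
`A_i` is `Ā_i φ_∞ - (e a²)⁻¹ φ_∞ × ∂_i φ_∞`; and `𝒪_{r^{-3}}(𝒢) = 0`. -/
structure BoundaryConditions (e a : ℝ) (C : ℕ → Fields) : Prop where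
  vacuum : ∀ x ≠ 0, (C 0).phi x ⬝ᵥ (C 0).phi x = a ^ 2
  orthogonal : ∀ x ≠ 0, (C 0).phi x ⬝ᵥ (C 1).phi x = 0
  phiMom_parallel : ∃ Pbar : Space → ℝ, ∀ x ≠ 0, (C 2).phiMom x = Pbar x • (C 0).phi x
  A_leading : ∃ Abar : Fin 3 → Space → ℝ, ∀ i, ∀ x ≠ 0,
    (C 1).A i x = Abar i x • (C 0).phi x
      - (e * a ^ 2)⁻¹ • ((C 0).phi x ⨯₃ pd i (C 0).phi x)
  gauss_third : ∀ x ≠ 0,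
    ∑ i, (pd i ((C 2).mom i) x + e • ((C 1).A i x ⨯₃ (C 2).mom i x))
      + e • ((C 1).phi x ⨯₃ (C 2).phiMom x) + e • ((C 0).phi x ⨯₃ (C 3).phiMom x) = 0

/-- All states that satisfy the fall-off and boundary conditions and the Gauss constraint. -/
def constraintSurface (e a : ℝ) : Set Fields :=
  {p | (∃ C, FallOff p C ∧ BoundaryConditions e a C) ∧ ∀ x, gauss e p x = 0}

/-! ### The action of the Poincaré algebra -/

/-- Elements of the Poincaré algebra: boost `b_i`, rotation `b_ij = - b_ji`, time translation
`a^⊥` and spatial translation `a^i`. -/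
structure Poincare where
  boost : Fin 3 → ℝ
  rot : Fin 3 → Fin 3 → ℝ
  rot_antisymm : ∀ i j, rot i j = - rot j i
  time : ℝ
  trans : Fin 3 → ℝ

/-- `ξ^⊥ = b_i x^i + a^⊥`. -/
def Poincare.perp (ξ : Poincare) (x : Space) : ℝ := ∑ i, ξ.boost i * x i + ξ.time

/-- `ξ^i = b^i_j x^j + a^i`. -/
def Poincare.tang (ξ : Poincare) (i : Fin 3) (x : Space) : ℝ := ∑ j, ξ.rot i j * x j + ξ.trans i

/-- The local Poincaré transformation `δ_ξ p` of the canonical variables, accompanied by the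
infinitesimal gauge transformation with parameter `ζ`. -/
noncomputable def poincareVariation (e a : ℝ) (ξ : Poincare) (ζ : Space → su2) (p : Fields) :
    Fields where
  A i x := ξ.perp x • p.mom i x + ∑ j, ξ.tang j x • pd j (p.A i) x
    + ∑ j, pd i (ξ.tang j) x • p.A j x - covD e p.A i ζ x
  mom i x := ∑ j, covD e p.A j (fun y => ξ.perp y • curvature e p.A j i y) x
    - (e * ξ.perp x) • (p.phi x ⨯₃ covD e p.A i p.phi x)
    + ∑ j, pd j (fun y => ξ.tang j y • p.mom i y) x
    - ∑ j, pd j (ξ.tang i) x • p.mom j x + e • (ζ x ⨯₃ p.mom i x)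
  phi x := ξ.perp x • p.phiMom x + ∑ j, ξ.tang j x • pd j p.phi x + e • (ζ x ⨯₃ p.phi x)
  phiMom x := ∑ l, covD e p.A l (fun y => ξ.perp y • covD e p.A l p.phi y) x
    - ξ.perp x • gradPotential a (p.phi x) + ∑ j, ξ.tang j x • pd j p.phiMom x
    + e • (ζ x ⨯₃ p.phiMom x)

/-! ### Tangency and invariance -/

/-- The family of functions `f t` has the `t`-derivative `v` at `t = 0` on `U`, together with all
spatial derivatives. This is a pointwise notion; it is implied by differentiability at `t = 0` in
the `C^∞` topology. -/
def HasVelocityOn (U : Set Space) (f : ℝ → Space → su2) (v : Space → su2) : Prop :=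
  ∀ k : ℕ, ∀ x ∈ U,
    HasDerivAt (fun t => iteratedFDeriv ℝ k (f t) x) (iteratedFDeriv ℝ k v x) 0

/-- `HasVelocityOn` for each of the canonical variables. -/
structure FieldsHaveVelocityOn (U : Set Space) (γ : ℝ → Fields) (v : Fields) : Prop where
  A : ∀ i, HasVelocityOn U (fun t => (γ t).A i) (v.A i)
  mom : ∀ i, HasVelocityOn U (fun t => (γ t).mom i) (v.mom i)
  phi : HasVelocityOn U (fun t => (γ t).phi) v.phi
  phiMom : HasVelocityOn U (fun t => (γ t).phiMom) v.phiMom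

/-- `v` is tangent to the set of states `S` at `p`: it is the velocity at `t = 0` of a curve `γ`
in `S` through `p`. The curve is differentiable as a curve of fields on the compactification of
`ℝ³` by a sphere at infinity: the velocity `v` obeys the fall-off conditions, and the coefficients
of the asymptotic expansions of `γ t` are differentiable at `t = 0` as well, with derivatives the
coefficients of `v`. -/
def IsTangent (S : Set Fields) (p v : Fields) : Prop :=
  ∃ (γ : ℝ → Fields) (C : ℝ → ℕ → Fields) (c : ℕ → Fields),
    γ 0 = p ∧ (∀ t, γ t ∈ S) ∧ (∀ t, FallOff (γ t) (C t)) ∧ FallOff v c ∧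
    FieldsHaveVelocityOn Set.univ γ v ∧
    ∀ n, FieldsHaveVelocityOn {0}ᶜ (fun t => C t n) (c n)

/-- The set of states `S` is invariant under the local action of the Poincaré algebra: at each
`p ∈ S` and for each `ξ`, the variation `δ_ξ p`, accompanied by some gauge transformation
`ζ ∼ ∑_{n ≥ 0} r^{-n} ζ⁽ⁿ⁾` (which may depend on `ξ` and on `p`), is tangent to `S`. -/
def PoincareInvariant (e a : ℝ) (S : Set Fields) : Prop :=
  ∀ p ∈ S, ∀ ξ : Poincare, ∃ ζ : Space → su2, (∃ z, HasExpansion ζ z) ∧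
    IsTangent S p (poincareVariation e a ξ ζ p)

end YMH

/-! Call u = ‖φ‖² − a². The four gauge covariant quantities u, D_iφ, Π and π^i × φ are shown to be
O(r^{-n}), derivatives included, for every n, by induction on n simultaneously for all states of the
invariant set. The fall-off and ‖φ_∞‖ = a give n = 1 (`decaysToOrder_one`).

For the step, let all states decay to order n. Along a curve in the set the expansion coefficients
of these quantities below order n are identically zero, so their t-derivatives vanish and the
linearised quantities, evaluated on δp, are again of order n (`IsTangent.isSymbol`). Take for δp the
boost with ξ^⊥ = x^j. Each linearised quantity is then x^j times another quantity on the list, up to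
terms already of order n; the gauge parameter contributes only such terms, by covariance. Dividing
by x^j, for all j together, gains one order (`IsSymbol.of_coord_smul`): δ(½‖φ‖²) gives φ · Π; δΠ
gives u; δ(D_iφ) gives π_i × φ; δ(π^i × φ) gives the part of D_iφ transverse to φ. Two parts remain:
φ · D_iφ = ½ ∂_i u, and the transverse part of Π, which the Gauss constraint expresses through the
others. This is `DecaysToOrder.succ`.

The formulas for A_i and π^i follow by decomposing them along and across φ, which is nonzero near
infinity. -/

namespace YMH

/-! ### Symbol classes: smooth functions with power decay of all derivatives -/

section Symbols

variable {V W U : Type*} [NormedAddCommGroup V] [NormedSpace ℝ V] [NormedAddCommGroup W]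
  [NormedSpace ℝ W] [NormedAddCommGroup U] [NormedSpace ℝ U]

/-- `f` is smooth away from the origin and is, together with all of its derivatives, of order
`r^{-n}` at infinity, each derivative improving the order by one. -/
structure IsSymbol (n : ℤ) (f : Space → V) : Prop where
  smooth : ContDiffOn ℝ ∞ f {0}ᶜ
  bound : ∀ k : ℕ,
    (fun x => iteratedFDeriv ℝ k f x) =O[cobounded Space] (fun x => ‖x‖ ^ (-(n + k)))

lemma isBigO_congr_norm {α V W : Type*} [NormedAddCommGroup V] [NormedAddCommGroup W]
    {l : Filter α} {f : α → V} {g : α → W} {h : α → ℝ}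
    (H : ∀ x, ‖f x‖ = ‖g x‖) : f =O[l] h ↔ g =O[l] h := by
  rw [← isBigO_norm_left, funext H, isBigO_norm_left]

lemma isOpen_punctured : IsOpen ({0}ᶜ : Set Space) := isOpen_compl_singleton

lemma eventually_ne_zero_cobounded : ∀ᶠ x in cobounded Space, x ≠ 0 := by
  filter_upwards [(tendsto_norm_cobounded_atTop (E := Space)).eventually_gt_atTop 0] with x hx
  exact norm_pos_iff.1 hx

lemma contDiffAt_of_punctured {f : Space → V} (hf : ContDiffOn ℝ ∞ f {0}ᶜ) {x : Space}
    (hx : x ≠ 0) : ContDiffAt ℝ ∞ f x :=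
  hf.contDiffAt (isOpen_punctured.mem_nhds hx)

lemma differentiableAt_of_punctured {f : Space → V} (hf : ContDiffOn ℝ ∞ f {0}ᶜ) {x : Space}
    (hx : x ≠ 0) : DifferentiableAt ℝ f x :=
  (contDiffAt_of_punctured hf hx).differentiableAt (by simp)

lemma eventuallyEq_of_punctured {V : Type*} {f g : Space → V} (h : ∀ x ≠ 0, f x = g x) {x : Space}
    (hx : x ≠ 0) : f =ᶠ[𝓝 x] g := by
  filter_upwards [isOpen_punctured.mem_nhds hx] with y hy using h y hy

lemma contDiffAt_infty_le {f : Space → V} {x : Space} (h : ContDiffAt ℝ ∞ f x) (k : ℕ) :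
    ContDiffAt ℝ k f x :=
  h.of_le (by exact_mod_cast le_top)

lemma isBigO_zpow_of_le {m n : ℤ} (h : m ≤ n) :
    (fun x : Space => ‖x‖ ^ (-n)) =O[cobounded Space] (fun x => ‖x‖ ^ (-m)) := by
  refine IsBigO.of_bound 1 ?_
  filter_upwards [(tendsto_norm_cobounded_atTop (E := Space)).eventually_ge_atTop 1] with x hx
  rw [one_mul, Real.norm_of_nonneg (by positivity), Real.norm_of_nonneg (by positivity)]
  exact zpow_le_zpow_right₀ hx (by omega)

lemma IsSymbol.congr {n : ℤ} {f g : Space → V} (hf : IsSymbol n f) (h : ∀ x ≠ 0, f x = g x) :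
    IsSymbol n g where
  smooth := hf.smooth.congr fun x hx => (h x hx).symm
  bound k := by
    refine (hf.bound k).congr' ?_ EventuallyEq.rfl
    filter_upwards [eventually_ne_zero_cobounded] with x hx
    exact ((eventuallyEq_of_punctured h hx).iteratedFDeriv ℝ k).eq_of_nhds

lemma IsSymbol.mono {m n : ℤ} {f : Space → V} (hf : IsSymbol n f) (h : m ≤ n) : IsSymbol m f where
  smooth := hf.smooth
  bound k := (hf.bound k).trans (isBigO_zpow_of_le (by omega))

lemma IsSymbol.zero (n : ℤ) : IsSymbol n (fun _ : Space => (0 : V)) where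
  smooth := contDiffOn_const
  bound k := by
    have : (fun x => iteratedFDeriv ℝ k (fun _ : Space => (0 : V)) x) = fun _ => 0 := by
      ext1 x; rw [iteratedFDeriv_fun_zero]; rfl
    rw [this]; exact isBigO_zero _ _

lemma IsSymbol.add {n : ℤ} {f g : Space → V} (hf : IsSymbol n f) (hg : IsSymbol n g) :
    IsSymbol n (fun x => f x + g x) where
  smooth := hf.smooth.add hg.smooth
  bound k := by
    refine ((hf.bound k).add (hg.bound k)).congr' ?_ EventuallyEq.rfl
    filter_upwards [eventually_ne_zero_cobounded] with x hx
    exact (iteratedFDeriv_add_apply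
      (contDiffAt_infty_le (contDiffAt_of_punctured hf.smooth hx) k)
      (contDiffAt_infty_le (contDiffAt_of_punctured hg.smooth hx) k)).symm

lemma IsSymbol.comp_clm {n : ℤ} {f : Space → V} (hf : IsSymbol n f) (L : V →L[ℝ] W) :
    IsSymbol n (fun x => L (f x)) where
  smooth := L.contDiff.comp_contDiffOn hf.smooth
  bound k := by
    refine IsBigO.trans (IsBigO.of_bound ‖L‖ ?_) (hf.bound k)
    filter_upwards [eventually_ne_zero_cobounded] with x hx
    exact L.norm_iteratedFDeriv_comp_left (contDiffAt_of_punctured hf.smooth hx)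
      (by exact_mod_cast le_top)

lemma IsSymbol.neg {n : ℤ} {f : Space → V} (hf : IsSymbol n f) : IsSymbol n (fun x => -f x) :=
  hf.comp_clm (-ContinuousLinearMap.id ℝ V)

lemma IsSymbol.sub {n : ℤ} {f g : Space → V} (hf : IsSymbol n f) (hg : IsSymbol n g) :
    IsSymbol n (fun x => f x - g x) := by
  simpa only [sub_eq_add_neg] using hf.add hg.neg

lemma IsSymbol.const_smul {n : ℤ} {f : Space → V} (hf : IsSymbol n f) (c : ℝ) :
    IsSymbol n (fun x => c • f x) :=
  hf.comp_clm (c • ContinuousLinearMap.id ℝ V)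

lemma IsSymbol.sum {ι : Type*} {n : ℤ} {f : ι → Space → V} {s : Finset ι}
    (hf : ∀ i ∈ s, IsSymbol n (f i)) : IsSymbol n (fun x => ∑ i ∈ s, f i x) := by
  classical
  induction s using Finset.induction_on with
  | empty => simpa using IsSymbol.zero n
  | insert i s hi ih =>
    simp only [Finset.sum_insert hi]
    exact (hf i (by simp)).add (ih fun j hj => hf j (by simp [hj]))

lemma IsSymbol.fderiv {n : ℤ} {f : Space → V} (hf : IsSymbol n f) :
    IsSymbol (n + 1) (fun x => fderiv ℝ f x) where
  smooth := hf.smooth.fderiv_of_isOpen isOpen_punctured (by simp)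
  bound k := by
    have h := hf.bound (k + 1)
    have e : -(n + ((k + 1 : ℕ) : ℤ)) = -(n + 1 + k) := by push_cast; ring
    rw [e] at h
    refine (isBigO_congr_norm ?_).2 h
    intro x
    exact norm_iteratedFDeriv_fderiv

lemma IsSymbol.pd {n : ℤ} {f : Space → V} (hf : IsSymbol n f) (i : Fin 3) :
    IsSymbol (n + 1) (pd i f) :=
  hf.fderiv.comp_clm (ContinuousLinearMap.apply ℝ V (EuclideanSpace.single i (1 : ℝ)))

/-- Leibniz rule: in each term the i derivatives on one factor and the k − i on the other improve
the order by k in total. -/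
lemma IsSymbol.bilinear {m n : ℤ} {f : Space → V} {g : Space → W} (hf : IsSymbol m f)
    (hg : IsSymbol n g) (B : V →L[ℝ] W →L[ℝ] U) : IsSymbol (m + n) (fun x => B (f x) (g x)) where
  smooth := B.isBoundedBilinearMap.contDiff.comp_contDiffOn (hf.smooth.prodMk hg.smooth)
  bound k := by
    have h : (fun x => ∑ i ∈ Finset.range (k + 1), (k.choose i : ℝ) *
        ‖iteratedFDeriv ℝ i f x‖ * ‖iteratedFDeriv ℝ (k - i) g x‖) =O[cobounded Space]
        (fun x => ‖x‖ ^ (-(m + n + k))) := by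
      refine IsBigO.fun_sum fun i hi => ?_
      have hi : i ≤ k := Nat.lt_succ_iff.1 (Finset.mem_range.1 hi)
      refine (((hf.bound i).norm_left.const_mul_left _).mul
        (hg.bound (k - i)).norm_left).congr' EventuallyEq.rfl ?_
      filter_upwards [eventually_ne_zero_cobounded] with x hx
      rw [← zpow_add₀ (norm_ne_zero_iff.2 hx)]
      congr 1
      push_cast [hi]
      ring
    refine IsBigO.trans (IsBigO.of_bound ‖B‖ ?_) h
    filter_upwards [eventually_ne_zero_cobounded] with x hx
    have key := B.norm_iteratedFDerivWithin_le_of_bilinear hf.smooth hg.smooth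
      isOpen_punctured.uniqueDiffOn hx (n := k) (by exact_mod_cast le_top)
    rw [iteratedFDerivWithin_of_isOpen k isOpen_punctured hx] at key
    refine key.trans ?_
    refine mul_le_mul_of_nonneg_left ?_ (norm_nonneg B)
    refine le_trans (le_of_eq ?_) (le_abs_self _)
    refine Finset.sum_congr rfl fun i _ => ?_
    rw [iteratedFDerivWithin_of_isOpen i isOpen_punctured hx,
      iteratedFDerivWithin_of_isOpen (k - i) isOpen_punctured hx]

lemma IsSymbol.isBigO {n : ℤ} {f : Space → V} (hf : IsSymbol n f) :
    f =O[cobounded Space] (fun x => ‖x‖ ^ (-n)) := by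
  have h := hf.bound 0
  refine (isBigO_congr_norm fun x => ?_).1 (by simpa using h)
  simp

/-- Positive homogeneity of degree `-n` away from the origin. -/
def IsHomogeneous (n : ℤ) (f : Space → V) : Prop :=
  ∀ (r : ℝ) (x : Space), 0 < r → x ≠ 0 → f (r • x) = r ^ (-n) • f x

/-- Differentiate the identity f(r y) = r^{-n} f(y) in y and cancel one factor r. -/
lemma IsHomogeneous.fderiv {n : ℤ} {f : Space → V} (h : IsHomogeneous n f)
    (hf : ContDiffOn ℝ ∞ f {0}ᶜ) : IsHomogeneous (n + 1) (fun x => fderiv ℝ f x) := by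
  intro r x hr hx
  have h1 : (fun y => f (r • y)) =ᶠ[𝓝 x] fun y => r ^ (-n) • f y :=
    eventuallyEq_of_punctured (fun y hy => h r y hr hy) hx
  have h2 := h1.fderiv_eq (𝕜 := ℝ)
  rw [fderiv_comp_smul, fderiv_fun_const_smul (differentiableAt_of_punctured hf hx)] at h2
  have h3 : -(n + 1) = -1 + -n := by ring
  rw [h3, zpow_add₀ hr.ne', mul_smul, ← h2, smul_smul, zpow_neg_one, inv_mul_cancel₀ hr.ne',
    one_smul]

lemma IsHomogeneous.isBigO {n : ℤ} {f : Space → V} (h : IsHomogeneous n f)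
    (hf : ContDiffOn ℝ ∞ f {0}ᶜ) : f =O[cobounded Space] (fun x => ‖x‖ ^ (-n)) := by
  obtain ⟨C, hC⟩ := (isCompact_sphere (0 : Space) 1).exists_bound_of_continuousOn
    (hf.continuousOn.mono fun x hx => by
      simpa using norm_ne_zero_iff.1 (by simp [mem_sphere_zero_iff_norm.1 hx]))
  refine IsBigO.of_bound C ?_
  filter_upwards [eventually_ne_zero_cobounded] with x hx
  have hx' : 0 < ‖x‖ := norm_pos_iff.2 hx
  have h1 : x = ‖x‖ • (‖x‖⁻¹ • x) := by rw [smul_smul, mul_inv_cancel₀ hx'.ne', one_smul]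
  have h2 : ‖‖x‖⁻¹ • x‖ = 1 := norm_smul_inv_norm hx
  have h3 : ‖x‖⁻¹ • x ≠ 0 := norm_ne_zero_iff.1 (by simp [h2])
  have h4 := h ‖x‖ _ hx' h3
  rw [← h1] at h4
  rw [h4, norm_smul, mul_comm]
  exact mul_le_mul_of_nonneg_right (hC _ (by simp [h2])) (norm_nonneg _)

/-- The induction on k passes from f to its derivative, whose values lie in another space; hence the
quantification over V inside the statement. -/
lemma isBigO_iteratedFDeriv_of_isHomogeneous (k : ℕ) :
    ∀ {V : Type*} [NormedAddCommGroup V] [NormedSpace ℝ V] {n : ℤ} {f : Space → V},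
      IsHomogeneous n f → ContDiffOn ℝ ∞ f {0}ᶜ →
      (fun x => iteratedFDeriv ℝ k f x) =O[cobounded Space] (fun x => ‖x‖ ^ (-(n + k))) := by
  induction k with
  | zero =>
    intro V _ _ n f h hf
    refine (isBigO_congr_norm fun x => ?_).2 (by simpa using h.isBigO hf)
    simp
  | succ k ih =>
    intro V _ _ n f h hf
    have := ih (h.fderiv hf) (hf.fderiv_of_isOpen isOpen_punctured (by simp))
    have e : -(n + ((k + 1 : ℕ) : ℤ)) = -(n + 1 + k) := by push_cast; ring
    rw [e]
    refine (isBigO_congr_norm ?_).1 this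
    intro x
    exact norm_iteratedFDeriv_fderiv

lemma IsHomogeneous.isSymbol {n : ℤ} {f : Space → V} (h : IsHomogeneous n f)
    (hf : ContDiffOn ℝ ∞ f {0}ᶜ) : IsSymbol n f :=
  ⟨hf, fun k => isBigO_iteratedFDeriv_of_isHomogeneous k h hf⟩

lemma isSymbol_const (v : V) : IsSymbol 0 (fun _ : Space => v) :=
  IsHomogeneous.isSymbol (fun r x _ _ => by simp) contDiffOn_const

/-- Coordinates grow, so orders have to be integers. -/
lemma isSymbol_coord (j : Fin 3) : IsSymbol (-1) (fun x : Space => x j) :=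
  IsHomogeneous.isSymbol (fun r x _ _ => by simp) (by fun_prop)

lemma isSymbol_coord_div (j : Fin 3) : IsSymbol 1 (fun x : Space => x j / ‖x‖ ^ 2) := by
  refine IsHomogeneous.isSymbol (fun r x hr hx => ?_) ?_
  · simp only [PiLp.smul_apply, smul_eq_mul, norm_smul, Real.norm_of_nonneg hr.le]
    have := norm_ne_zero_iff.2 hx
    rw [zpow_neg_one]
    field_simp
  · refine ContDiffOn.div (by fun_prop) (contDiff_norm_sq ℝ).contDiffOn fun x hx => ?_
    simpa using hx

/-- A function all of whose products with the Cartesian coordinates are of order `r^{-n}` is of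
order `r^{-n-1}`. -/
lemma IsSymbol.of_coord_smul {n : ℤ} {f : Space → V} (h : ∀ j, IsSymbol n (fun x => x j • f x)) :
    IsSymbol (n + 1) f := by
  -- Away from the origin f = Σ_j (x_j / r²) (x_j f), and x_j / r² has order 1.
  have h1 : IsSymbol (n + 1) (fun x : Space => ∑ j, (x j / ‖x‖ ^ 2) • x j • f x) :=
    IsSymbol.sum fun j _ =>
      add_comm n 1 ▸ (isSymbol_coord_div j).bilinear (h j) (ContinuousLinearMap.lsmul ℝ ℝ)
  refine h1.congr fun x hx => ?_
  have h2 : ‖x‖ ^ 2 ≠ 0 := by simpa using hx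
  have h3 : ∑ j, x j / ‖x‖ ^ 2 * x j = 1 := by
    simp only [div_mul_eq_mul_div, ← sq, ← Finset.sum_div]
    rw [← EuclideanSpace.real_norm_sq_eq, div_self h2]
  simp only [smul_smul, ← Finset.sum_smul, h3, one_smul]

end Symbols

/-! ### Asymptotic expansions, and velocities of their coefficients -/

section Expansions

variable {V W U : Type*} [NormedAddCommGroup V] [NormedSpace ℝ V] [NormedAddCommGroup W]
  [NormedSpace ℝ W] [NormedAddCommGroup U] [NormedSpace ℝ U]

/-- `f ∼ ∑ n, c n` with `c n` homogeneous of degree `-n`, for `f` smooth away from the origin. -/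
structure HasAsymptotics (f : Space → V) (c : ℕ → Space → V) : Prop where
  homogeneous : ∀ n : ℕ, IsHomogeneous n (c n)
  remainder : ∀ N : ℕ, IsSymbol N (fun x => f x - ∑ n ∈ Finset.range N, c n x)

lemma HasExpansion.hasAsymptotics {f : Space → su2} {c : ℕ → Space → su2}
    (h : HasExpansion f c) : HasAsymptotics f c where
  homogeneous n r x hr hx := by rw [h.homogeneous n r x hr hx, zpow_neg, zpow_natCast]
  remainder N :=
    { smooth := h.smooth.contDiffOn.sub (ContDiffOn.sum fun n _ => h.smooth_coeff n)
      bound := fun k => by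
        have := h.remainder N k
        simpa only [← zpow_natCast, ← zpow_neg, Nat.cast_add] using this }

lemma HasAsymptotics.isSymbol {f : Space → V} {c : ℕ → Space → V} (h : HasAsymptotics f c) :
    IsSymbol 0 f := by
  simpa using h.remainder 0

/-- A coefficient is the difference of two consecutive remainders. -/
lemma HasAsymptotics.isSymbol_coeff {f : Space → V} {c : ℕ → Space → V} (h : HasAsymptotics f c)
    (n : ℕ) : IsSymbol n (c n) := by
  refine ((h.remainder n).sub ((h.remainder (n + 1)).mono (by push_cast; omega))).congr
    fun x _ => ?_
  rw [Finset.sum_range_succ]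
  abel

lemma HasAsymptotics.isSymbol_of_coeff_eq_zero {f : Space → V} {c : ℕ → Space → V}
    (h : HasAsymptotics f c) {n : ℕ} (hc : ∀ k < n, ∀ x ≠ 0, c k x = 0) : IsSymbol n f := by
  refine (h.remainder n).congr fun x hx => ?_
  rw [Finset.sum_eq_zero fun k hk => hc k (Finset.mem_range.1 hk) x hx, sub_zero]

/-- Along the ray r x the function is exactly r^{-n} f(x) and also O(r^{-n-1}); let r → ∞. -/
lemma IsHomogeneous.eq_zero_of_isSymbol {n : ℕ} {f : Space → V} (h : IsHomogeneous n f)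
    (hf : IsSymbol (n + 1) f) {x : Space} (hx : x ≠ 0) : f x = 0 := by
  obtain ⟨C, hC⟩ := hf.isBigO.bound
  have hx' : 0 < ‖x‖ := norm_pos_iff.2 hx
  have ht : Tendsto (fun r : ℝ => r • x) atTop (cobounded Space) := by
    rw [← tendsto_norm_atTop_iff_cobounded]
    simp only [norm_smul]
    exact tendsto_norm_atTop_atTop.atTop_mul_const hx'
  have h1 : ∀ᶠ r : ℝ in atTop, ‖f x‖ ≤ (C * ‖x‖ ^ (-((n : ℤ) + 1))) * r⁻¹ := by
    filter_upwards [ht.eventually hC, eventually_gt_atTop 0] with r hr hr0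
    rw [h r x hr0 hx, norm_smul, norm_smul, norm_zpow, norm_zpow, norm_mul, norm_norm, norm_norm,
      Real.norm_of_nonneg hr0.le, mul_zpow, neg_add, zpow_add₀ hr0.ne', zpow_neg_one] at hr
    refine le_of_mul_le_mul_left (hr.trans (le_of_eq ?_)) (zpow_pos hr0 (-(n : ℤ)))
    rw [neg_add]
    ring
  have h2 : Tendsto (fun r : ℝ => (C * ‖x‖ ^ (-((n : ℤ) + 1))) * r⁻¹) atTop (𝓝 0) := by
    simpa using tendsto_inv_atTop_zero.const_mul (C * ‖x‖ ^ (-((n : ℤ) + 1)))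
  exact norm_le_zero_iff.1 (ge_of_tendsto h2 h1)

lemma HasAsymptotics.coeff_eq_zero {f : Space → V} {c : ℕ → Space → V} (h : HasAsymptotics f c)
    {n : ℕ} (hf : IsSymbol n f) {k : ℕ} (hk : k < n) : ∀ x ≠ 0, c k x = 0 := by
  induction k using Nat.strong_induction_on with
  | _ k ih =>
    intro x hx
    refine (h.homogeneous k).eq_zero_of_isSymbol ?_ hx
    refine ((hf.mono (by omega)).sub (by exact_mod_cast h.remainder (k + 1))).congr fun y hy => ?_
    rw [Finset.sum_range_succ,
      Finset.sum_eq_zero fun j hj => ih j (Finset.mem_range.1 hj)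
        ((Finset.mem_range.1 hj).trans hk) y hy]
    abel

lemma hasAsymptotics_const (v : V) :
    HasAsymptotics (fun _ => v) (fun n _ => if n = 0 then v else 0) where
  homogeneous n r x _ _ := by by_cases h : n = 0 <;> simp [h]
  remainder N := by
    cases N with
    | zero => simpa using isSymbol_const v
    | succ N => simpa [Finset.sum_range_succ'] using IsSymbol.zero _

lemma HasAsymptotics.add {f g : Space → V} {c d : ℕ → Space → V} (hf : HasAsymptotics f c)
    (hg : HasAsymptotics g d) : HasAsymptotics (fun x => f x + g x) (fun n x => c n x + d n x) where
  homogeneous n r x hr hx := by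
    simp only [hf.homogeneous n r x hr hx, hg.homogeneous n r x hr hx, smul_add]
  remainder N := ((hf.remainder N).add (hg.remainder N)).congr fun x _ => by
    rw [Finset.sum_add_distrib]; abel

lemma HasAsymptotics.bilinear {f : Space → V} {g : Space → W} {c : ℕ → Space → V}
    {d : ℕ → Space → W} (hf : HasAsymptotics f c) (hg : HasAsymptotics g d)
    (B : V →L[ℝ] W →L[ℝ] U) :
    HasAsymptotics (fun x => B (f x) (g x))
      (fun n x => ∑ k ∈ Finset.range (n + 1), B (c k x) (d (n - k) x)) where
  homogeneous n r x hr hx := by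
    rw [Finset.smul_sum]
    refine Finset.sum_congr rfl fun k hk => ?_
    have hk : k ≤ n := Nat.lt_succ_iff.1 (Finset.mem_range.1 hk)
    rw [hf.homogeneous k r x hr hx, hg.homogeneous (n - k) r x hr hx, map_smul, map_smul,
      _root_.smul_apply, smul_smul, ← zpow_add₀ hr.ne']
    congr 2
    push_cast [hk]
    ring
  remainder N := by
    -- The remainder of the Cauchy product splits as B(f − Σ_{k<N} c_k, g) + Σ_{k<N} B(c_k, g −
    -- Σ_{m<N−k} d_m).
    have h1 : IsSymbol N fun x => B (f x - ∑ n ∈ Finset.range N, c n x) (g x) := by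
      simpa using (hf.remainder N).bilinear hg.isSymbol B
    have h2 : IsSymbol N fun x => ∑ k ∈ Finset.range N,
        B (c k x) (g x - ∑ n ∈ Finset.range (N - k), d n x) := by
      refine IsSymbol.sum fun k hk => ?_
      have hk : k ≤ N := (Finset.mem_range.1 hk).le
      simpa [hk] using (hf.isSymbol_coeff k).bilinear (hg.remainder (N - k)) B
    refine (h1.add h2).congr fun x _ => ?_
    rw [Finset.sum_range_diag_flip N fun i j => B (c i x) (d j x)]
    simp only [map_sub, map_sum, _root_.sub_apply, _root_.sum_apply,
      Finset.sum_sub_distrib]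
    abel

/-- A derivative raises the order by one, so the coefficients are shifted by one place. -/
lemma HasExpansion.hasAsymptotics_pd {f : Space → su2} {c : ℕ → Space → su2}
    (h : HasExpansion f c) (i : Fin 3) :
    HasAsymptotics (pd i f) (fun n x => if n = 0 then 0 else pd i (c (n - 1)) x) where
  homogeneous n := by
    cases n with
    | zero => intro r x _ _; simp
    | succ n =>
      intro r x hr hx
      have : fderiv ℝ (c n) (r • x) = r ^ (-((n : ℤ) + 1)) • fderiv ℝ (c n) x :=
        (h.hasAsymptotics.homogeneous n).fderiv (h.smooth_coeff n) r x hr hx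
      simp only [Nat.succ_ne_zero, if_false, Nat.add_sub_cancel, pd]
      rw [this]
      simp
  remainder N := by
    cases N with
    | zero => simpa using (h.hasAsymptotics.isSymbol.pd i).mono (by omega)
    | succ N =>
      refine (((h.hasAsymptotics.remainder N).pd i).congr fun x hx => ?_)
      have hd : ∀ n, DifferentiableAt ℝ (c n) x :=
        fun n => differentiableAt_of_punctured (h.smooth_coeff n) hx
      rw [Finset.sum_range_succ']
      simp only [pd, Nat.succ_ne_zero, if_false, Nat.add_sub_cancel, if_true, add_zero]
      rw [fderiv_fun_sub (h.smooth.differentiable (by simp) x)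
        (DifferentiableAt.fun_sum fun n _ => hd n), fderiv_fun_sum fun n _ => hd n]
      simp

/-- `v` is the derivative at `t = 0` of the family `f t` at the level of the coefficients of
asymptotic expansions. -/
def HasAsymptoticVelocity (f : ℝ → Space → V) (v : Space → V) : Prop :=
  ∃ (c : ℝ → ℕ → Space → V) (d : ℕ → Space → V), (∀ t, HasAsymptotics (f t) (c t)) ∧
    HasAsymptotics v d ∧ ∀ n, ∀ x ≠ 0, HasDerivAt (fun t => c t n x) (d n x) 0

/-- Decay passes to the velocity without any uniformity in t: the coefficients below order n vanish
for every t, hence so do their derivatives, and the expansion of v starts at order n. -/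
lemma HasAsymptoticVelocity.isSymbol {f : ℝ → Space → V} {v : Space → V}
    (h : HasAsymptoticVelocity f v) {n : ℕ} (hf : ∀ t, IsSymbol n (f t)) : IsSymbol n v := by
  obtain ⟨c, d, hc, hd, hcd⟩ := h
  refine hd.isSymbol_of_coeff_eq_zero fun k hk x hx => ?_
  have h1 : (fun t => c t k x) = fun _ => 0 :=
    funext fun t => (hc t).coeff_eq_zero (hf t) hk x hx
  have h2 := hcd k x hx
  rw [h1] at h2
  exact h2.unique (hasDerivAt_const _ _)

lemma hasAsymptoticVelocity_const (v : V) :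
    HasAsymptoticVelocity (fun _ _ => v) (fun _ => 0) :=
  ⟨_, _, fun _ => hasAsymptotics_const v, hasAsymptotics_const 0,
    fun n x _ => by simpa using hasDerivAt_const _ _⟩

lemma HasAsymptoticVelocity.add {f g : ℝ → Space → V} {v w : Space → V}
    (hf : HasAsymptoticVelocity f v) (hg : HasAsymptoticVelocity g w) :
    HasAsymptoticVelocity (fun t x => f t x + g t x) (fun x => v x + w x) := by
  obtain ⟨c, d, hc, hd, hcd⟩ := hf
  obtain ⟨c', d', hc', hd', hcd'⟩ := hg
  exact ⟨_, _, fun t => (hc t).add (hc' t), hd.add hd',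
    fun n x hx => (hcd n x hx).add (hcd' n x hx)⟩

lemma HasAsymptoticVelocity.bilinear {f : ℝ → Space → V} {g : ℝ → Space → W} {v : Space → V}
    {w : Space → W} (hf : HasAsymptoticVelocity f v) (hg : HasAsymptoticVelocity g w)
    (B : V →L[ℝ] W →L[ℝ] U) {F : Space → V} {G : Space → W} (hF : f 0 = F) (hG : g 0 = G) :
    HasAsymptoticVelocity (fun t x => B (f t x) (g t x))
      (fun x => B (F x) (w x) + B (v x) (G x)) := by
  subst hF hG
  obtain ⟨c, d, hc, hd, hcd⟩ := hf
  obtain ⟨c', d', hc', hd', hcd'⟩ := hg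
  refine ⟨_, _, fun t => (hc t).bilinear (hc' t) B,
    ((hc 0).bilinear hd' B).add (hd.bilinear (hc' 0) B), fun n x hx => ?_⟩
  rw [← Finset.sum_add_distrib]
  exact HasDerivAt.fun_sum fun k _ =>
    B.hasDerivAt_of_bilinear (fun _ => hcd k x hx) fun _ => hcd' (n - k) x hx

lemma HasVelocityOn.hasDerivAt {s : Set Space} {f : ℝ → Space → su2} {v : Space → su2}
    (h : HasVelocityOn s f v) {x : Space} (hx : x ∈ s) :
    HasDerivAt (fun t => f t x) (v x) 0 := by
  have := (ContinuousMultilinearMap.apply ℝ (fun _ : Fin 0 => Space) su2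
    0).hasFDerivAt.comp_hasDerivAt (0 : ℝ) (h 0 x hx)
  simpa [Function.comp_def] using this

lemma HasVelocityOn.hasDerivAt_pd {s : Set Space} {f : ℝ → Space → su2} {v : Space → su2}
    (h : HasVelocityOn s f v) {x : Space} (hx : x ∈ s) (i : Fin 3) :
    HasDerivAt (fun t => pd i (f t) x) (pd i v x) 0 := by
  have := (ContinuousMultilinearMap.apply ℝ (fun _ : Fin 1 => Space) su2
    fun _ => EuclideanSpace.single i 1).hasFDerivAt.comp_hasDerivAt (0 : ℝ) (h 1 x hx)
  simpa [Function.comp_def, iteratedFDeriv_one_apply, ← pd.eq_1] using this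

section Velocity

variable {f : ℝ → Space → su2} {v : Space → su2} {c : ℝ → ℕ → Space → su2} {d : ℕ → Space → su2}

lemma hasAsymptoticVelocity_of_hasVelocityOn (hf : ∀ t, HasExpansion (f t) (c t))
    (hv : HasExpansion v d) (h : ∀ n, HasVelocityOn {0}ᶜ (fun t => c t n) (d n)) :
    HasAsymptoticVelocity f v :=
  ⟨c, d, fun t => (hf t).hasAsymptotics, hv.hasAsymptotics, fun n _ hx => (h n).hasDerivAt hx⟩

lemma hasAsymptoticVelocity_pd_of_hasVelocityOn (hf : ∀ t, HasExpansion (f t) (c t))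
    (hv : HasExpansion v d) (h : ∀ n, HasVelocityOn {0}ᶜ (fun t => c t n) (d n)) (i : Fin 3) :
    HasAsymptoticVelocity (fun t => pd i (f t)) (pd i v) := by
  refine ⟨_, _, fun t => (hf t).hasAsymptotics_pd i, hv.hasAsymptotics_pd i, fun n x hx => ?_⟩
  by_cases hn : n = 0
  · simpa [hn] using hasDerivAt_const _ _
  · simpa [hn] using (h (n - 1)).hasDerivAt_pd hx i

end Velocity

end Expansions

/-! ### Covariant derivative and curvature -/

section Calculus

/-- The cross product as a continuous bilinear map. -/
noncomputable def crossL : su2 →L[ℝ] su2 →L[ℝ] su2 :=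
  (crossProduct : su2 →ₗ[ℝ] su2 →ₗ[ℝ] su2).toContinuousBilinearMap

/-- The inner product as a continuous bilinear map. -/
noncomputable def dotL : su2 →L[ℝ] su2 →L[ℝ] ℝ :=
  (dotProductBilin ℝ ℝ : su2 →ₗ[ℝ] su2 →ₗ[ℝ] ℝ).toContinuousBilinearMap

@[simp] lemma crossL_apply (v w : su2) : crossL v w = v ⨯₃ w := rfl

@[simp] lemma dotL_apply (v w : su2) : dotL v w = v ⬝ᵥ w := rfl

lemma IsSymbol.cross {m n : ℤ} {f g : Space → su2} (hf : IsSymbol m f) (hg : IsSymbol n g) :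
    IsSymbol (m + n) (fun x => f x ⨯₃ g x) :=
  hf.bilinear hg crossL

lemma IsSymbol.dot {m n : ℤ} {f g : Space → su2} (hf : IsSymbol m f) (hg : IsSymbol n g) :
    IsSymbol (m + n) (fun x => f x ⬝ᵥ g x) :=
  hf.bilinear hg dotL

lemma IsSymbol.smul {V : Type*} [NormedAddCommGroup V] [NormedSpace ℝ V] {m n : ℤ}
    {f : Space → ℝ} {g : Space → V} (hf : IsSymbol m f) (hg : IsSymbol n g) :
    IsSymbol (m + n) (fun x => f x • g x) :=
  hf.bilinear hg (ContinuousLinearMap.lsmul ℝ ℝ)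

lemma contDiff_cross {f g : Space → su2} (hf : ContDiff ℝ ∞ f) (hg : ContDiff ℝ ∞ g) :
    ContDiff ℝ ∞ (fun x => f x ⨯₃ g x) :=
  crossL.isBoundedBilinearMap.contDiff.comp (hf.prodMk hg)

lemma contDiff_pd {V : Type*} [NormedAddCommGroup V] [NormedSpace ℝ V] {f : Space → V}
    (hf : ContDiff ℝ ∞ f) (i : Fin 3) : ContDiff ℝ ∞ (pd i f) :=
  (hf.fderiv_right (by simp)).clm_apply contDiff_const

lemma contDiff_covD {e : ℝ} {A : Fin 3 → Space → su2} {f : Space → su2} {i : Fin 3}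
    (hA : ContDiff ℝ ∞ (A i)) (hf : ContDiff ℝ ∞ f) : ContDiff ℝ ∞ (covD e A i f) :=
  (contDiff_pd hf i).add ((contDiff_cross hA hf).const_smul e)

lemma contDiff_curvature {e : ℝ} {A : Fin 3 → Space → su2} (hA : ∀ i, ContDiff ℝ ∞ (A i))
    (i j : Fin 3) : ContDiff ℝ ∞ (curvature e A i j) :=
  ((contDiff_pd (hA j) i).sub (contDiff_pd (hA i) j)).add
    ((contDiff_cross (hA i) (hA j)).const_smul e)

lemma IsSymbol.covD {e : ℝ} {A : Fin 3 → Space → su2} {f : Space → su2} {n : ℤ} {i : Fin 3}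
    (hA : IsSymbol 1 (A i)) (hf : IsSymbol n f) : IsSymbol (n + 1) (covD e A i f) :=
  (hf.pd i).add ((add_comm (1 : ℤ) n ▸ hA.cross hf).const_smul e)

lemma isSymbol_curvature {e : ℝ} {A : Fin 3 → Space → su2} (hA : ∀ i, IsSymbol 1 (A i))
    (i j : Fin 3) : IsSymbol 2 (curvature e A i j) :=
  (((hA j).pd i).sub ((hA i).pd j)).add (((hA i).cross (hA j)).const_smul e)

lemma pd_add {V : Type*} [NormedAddCommGroup V] [NormedSpace ℝ V] {f g : Space → V} {x : Space}
    (hf : DifferentiableAt ℝ f x) (hg : DifferentiableAt ℝ g x) (i : Fin 3) :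
    pd i (fun y => f y + g y) x = pd i f x + pd i g x := by
  simp only [pd]
  rw [fderiv_fun_add hf hg]
  rfl

lemma pd_const_smul {V : Type*} [NormedAddCommGroup V] [NormedSpace ℝ V] {f : Space → V}
    {x : Space} (hf : DifferentiableAt ℝ f x) (c : ℝ) (i : Fin 3) :
    pd i (fun y => c • f y) x = c • pd i f x := by
  simp only [pd]
  rw [fderiv_fun_const_smul hf]
  rfl

lemma pd_bilinear {V W U : Type*} [NormedAddCommGroup V] [NormedSpace ℝ V] [NormedAddCommGroup W]
    [NormedSpace ℝ W] [NormedAddCommGroup U] [NormedSpace ℝ U] (B : V →L[ℝ] W →L[ℝ] U)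
    {f : Space → V} {g : Space → W} {x : Space} (hf : DifferentiableAt ℝ f x)
    (hg : DifferentiableAt ℝ g x) (i : Fin 3) :
    pd i (fun y => B (f y) (g y)) x = B (f x) (pd i g x) + B (pd i f x) (g x) := by
  simp only [pd]
  rw [B.fderiv_of_bilinear hf hg]
  rfl

lemma pd_cross {f g : Space → su2} {x : Space} (hf : DifferentiableAt ℝ f x)
    (hg : DifferentiableAt ℝ g x) (i : Fin 3) :
    pd i (fun y => f y ⨯₃ g y) x = f x ⨯₃ pd i g x + pd i f x ⨯₃ g x :=
  pd_bilinear crossL hf hg i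

lemma pd_dot {f g : Space → su2} {x : Space} (hf : DifferentiableAt ℝ f x)
    (hg : DifferentiableAt ℝ g x) (i : Fin 3) :
    pd i (fun y => f y ⬝ᵥ g y) x = f x ⬝ᵥ pd i g x + pd i f x ⬝ᵥ g x :=
  pd_bilinear dotL hf hg i

lemma pd_comm {V : Type*} [NormedAddCommGroup V] [NormedSpace ℝ V] {f : Space → V}
    (hf : ContDiff ℝ ∞ f) (i j : Fin 3) (x : Space) : pd i (pd j f) x = pd j (pd i f) x := by
  have hd : DifferentiableAt ℝ (fderiv ℝ f) x :=
    (hf.fderiv_right (m := ∞) (by simp)).differentiable (by simp) x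
  have h : ∀ k l, pd k (pd l f) x
      = fderiv ℝ (fderiv ℝ f) x (EuclideanSpace.single k 1) (EuclideanSpace.single l 1) := by
    intro k l
    have : pd l f = fun y => fderiv ℝ f y (EuclideanSpace.single l 1) := rfl
    rw [this]
    simp only [pd]
    rw [fderiv_clm_apply hd (differentiableAt_const _)]
    simp
  rw [h, h]
  exact ((contDiffAt_infty_le hf.contDiffAt 2).isSymmSndFDerivAt (by simp)) _ _

lemma differentiableAt_cross {f g : Space → su2} {x : Space} (hf : DifferentiableAt ℝ f x)
    (hg : DifferentiableAt ℝ g x) : DifferentiableAt ℝ (fun y => f y ⨯₃ g y) x :=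
  (crossL.hasFDerivAt_of_bilinear hf.hasFDerivAt hg.hasFDerivAt).differentiableAt

/-- By the Jacobi identity, A_i × · is a derivation of the cross product. -/
lemma covD_cross {e : ℝ} {A : Fin 3 → Space → su2} {f g : Space → su2} {x : Space}
    (hf : DifferentiableAt ℝ f x) (hg : DifferentiableAt ℝ g x) (i : Fin 3) :
    covD e A i (fun y => f y ⨯₃ g y) x = f x ⨯₃ covD e A i g x + covD e A i f x ⨯₃ g x := by
  simp only [covD]
  rw [pd_cross hf hg, leibniz_cross]
  simp only [map_add, map_smul, LinearMap.add_apply, LinearMap.smul_apply, smul_add]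
  abel

lemma covD_add {e : ℝ} {A : Fin 3 → Space → su2} {f g : Space → su2} {x : Space}
    (hf : DifferentiableAt ℝ f x) (hg : DifferentiableAt ℝ g x) (i : Fin 3) :
    covD e A i (fun y => f y + g y) x = covD e A i f x + covD e A i g x := by
  simp only [covD]
  rw [pd_add hf hg]
  simp only [map_add, smul_add]
  abel

lemma covD_const_smul {e : ℝ} {A : Fin 3 → Space → su2} {f : Space → su2} {x : Space}
    (hf : DifferentiableAt ℝ f x) (c : ℝ) (i : Fin 3) :
    covD e A i (fun y => c • f y) x = c • covD e A i f x := by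
  simp only [covD]
  rw [pd_const_smul hf, map_smul, smul_add, smul_comm e c]

/-- The commutator of covariant derivatives is the curvature. -/
lemma curvature_cross {e : ℝ} {A : Fin 3 → Space → su2} {f : Space → su2}
    (hA : ∀ i, ContDiff ℝ ∞ (A i)) (hf : ContDiff ℝ ∞ f) (i j : Fin 3) (x : Space) :
    e • (curvature e A i j x ⨯₃ f x) = covD e A i (covD e A j f) x - covD e A j (covD e A i f) x := by
  have dA : ∀ k, DifferentiableAt ℝ (A k) x := fun k => (hA k).differentiable (by simp) x
  have df : DifferentiableAt ℝ f x := hf.differentiable (by simp) x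
  have h : ∀ k l, covD e A k (covD e A l f) x = pd k (pd l f) x
      + e • (A l x ⨯₃ pd k f x + pd k (A l) x ⨯₃ f x)
      + e • (A k x ⨯₃ (pd l f x + e • (A l x ⨯₃ f x))) := by
    intro k l
    have : covD e A l f = fun y => pd l f y + e • (A l y ⨯₃ f y) := rfl
    rw [this, covD, pd_add ((contDiff_pd hf l).differentiable (by simp) x)
      ((differentiableAt_cross (dA l) df).fun_const_smul e),
      pd_const_smul (differentiableAt_cross (dA l) df), pd_cross (dA l) df]
  rw [h, h, pd_comm hf j i]
  simp only [curvature, map_add, map_sub, map_smul, LinearMap.add_apply, LinearMap.sub_apply,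
    LinearMap.smul_apply]
  rw [leibniz_cross (A i x) (A j x) (f x)]
  module

end Calculus

/-! ### The variation of the fields under a coordinate boost -/

section Boosts

/-- The boost in the direction of the `j`-th coordinate axis. -/
def boostAlong (j : Fin 3) : Poincare where
  boost := Pi.single j 1
  rot _ _ := 0
  rot_antisymm _ _ := by simp
  time := 0
  trans _ := 0

lemma boostAlong_perp (j : Fin 3) : (boostAlong j).perp = fun x => x j := by
  funext x
  simp [Poincare.perp, boostAlong, Pi.single_apply]

lemma boostAlong_tang (j i : Fin 3) : (boostAlong j).tang i = fun _ => 0 := by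
  funext x
  simp [Poincare.tang, boostAlong]

lemma pd_zero {V : Type*} [NormedAddCommGroup V] [NormedSpace ℝ V] (i : Fin 3) (x : Space) :
    pd i (fun _ => (0 : V)) x = 0 := by
  simp [pd]

variable {e a : ℝ} {ζ : Space → su2} {p : Fields} (j : Fin 3)

lemma boost_variation_A (i : Fin 3) (x : Space) :
    (poincareVariation e a (boostAlong j) ζ p).A i x = x j • p.mom i x - covD e p.A i ζ x := by
  simp [poincareVariation, boostAlong_perp, boostAlong_tang, pd_zero]

lemma boost_variation_mom (i : Fin 3) (x : Space) :
    (poincareVariation e a (boostAlong j) ζ p).mom i x =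
      ∑ k, covD e p.A k (fun y => y j • curvature e p.A k i y) x
        - (e * x j) • (p.phi x ⨯₃ covD e p.A i p.phi x) + e • (ζ x ⨯₃ p.mom i x) := by
  simp [poincareVariation, boostAlong_perp, boostAlong_tang, pd_zero]

lemma boost_variation_phi (x : Space) :
    (poincareVariation e a (boostAlong j) ζ p).phi x
      = x j • p.phiMom x + e • (ζ x ⨯₃ p.phi x) := by
  simp [poincareVariation, boostAlong_perp, boostAlong_tang]

lemma gradPotential_eq (a : ℝ) (v : su2) : gradPotential a v = (4 * (v ⬝ᵥ v - a ^ 2)) • v := by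
  funext k
  have h1 : HasFDerivAt (fun w : su2 => w ⬝ᵥ w)
      (dotL.precompR su2 v (ContinuousLinearMap.id ℝ su2)
        + dotL.precompL su2 (ContinuousLinearMap.id ℝ su2) v) v :=
    dotL.hasFDerivAt_of_bilinear (hasFDerivAt_id v) (hasFDerivAt_id v)
  have h2 := (h1.sub_const (a ^ 2)).pow 2
  have h3 : gradPotential a v k = fderiv ℝ (fun w : su2 => (w ⬝ᵥ w - a ^ 2) ^ 2) v
    (Pi.single k 1) := rfl
  rw [h3, h2.fderiv]
  simp [ContinuousLinearMap.precompR, ContinuousLinearMap.precompL]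
  ring

lemma boost_variation_phiMom (x : Space) :
    (poincareVariation e a (boostAlong j) ζ p).phiMom x =
      ∑ l, covD e p.A l (fun y => y j • covD e p.A l p.phi y) x
        - x j • (4 * (p.phi x ⬝ᵥ p.phi x - a ^ 2)) • p.phi x + e • (ζ x ⨯₃ p.phiMom x) := by
  simp [poincareVariation, boostAlong_perp, boostAlong_tang, gradPotential_eq]

end Boosts

/-! ### The inductive decay property and its linearisation -/

section Decay

/-- The smoothness and the fall-off of the canonical variables. -/
structure IsRegular (p : Fields) : Prop where
  smooth_A : ∀ i, ContDiff ℝ ∞ (p.A i)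
  smooth_mom : ∀ i, ContDiff ℝ ∞ (p.mom i)
  smooth_phi : ContDiff ℝ ∞ p.phi
  smooth_phiMom : ContDiff ℝ ∞ p.phiMom
  A : ∀ i, IsSymbol 1 (p.A i)
  mom : ∀ i, IsSymbol 2 (p.mom i)
  phi : IsSymbol 0 p.phi
  phiMom : IsSymbol 2 p.phiMom

lemma FallOff.isRegular {p : Fields} {C : ℕ → Fields} (h : FallOff p C) : IsRegular p where
  smooth_A i := (h.A i).smooth
  smooth_mom i := (h.mom i).smooth
  smooth_phi := h.phi.smooth
  smooth_phiMom := h.phiMom.smooth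
  A i := (h.A i).hasAsymptotics.isSymbol_of_coeff_eq_zero (n := 1) (h.A_lead i)
  mom i := (h.mom i).hasAsymptotics.isSymbol_of_coeff_eq_zero (n := 2) (h.mom_lead i)
  phi := h.phi.hasAsymptotics.isSymbol
  phiMom := h.phiMom.hasAsymptotics.isSymbol_of_coeff_eq_zero (n := 2) h.phiMom_lead

/-- The gauge covariant quantities that vanish on the unbroken asymptotic configurations are of
order `r^{-n}`. -/
structure DecaysToOrder (e a : ℝ) (n : ℤ) (p : Fields) : Prop where
  vacuum : IsSymbol n (fun x => p.phi x ⬝ᵥ p.phi x - a ^ 2)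
  covD : ∀ i, IsSymbol n (covD e p.A i p.phi)
  phiMom : IsSymbol n p.phiMom
  mom : ∀ i, IsSymbol n (fun x => p.mom i x ⨯₃ p.phi x)

/-- The leading term of ‖φ‖² − a² cancels because ‖φ_∞‖ = a; the other three decay by the fall-off
alone. -/
lemma decaysToOrder_one {e a : ℝ} {p : Fields} (hp : p ∈ constraintSurface e a) :
    DecaysToOrder e a 1 p := by
  obtain ⟨⟨C, hC, hB⟩, -⟩ := hp
  have hr := hC.isRegular
  have h0 : IsSymbol 0 (C 0).phi := hC.phi.hasAsymptotics.isSymbol_coeff 0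
  have h1 : IsSymbol 1 (fun x => p.phi x - (C 0).phi x) := by
    simpa using hC.phi.hasAsymptotics.remainder 1
  refine ⟨?_, fun i => ?_, hr.phiMom.mono (by norm_num), fun i => ?_⟩
  · refine ((h1.dot hr.phi).add (add_comm (0 : ℤ) 1 ▸ h0.dot h1)).congr fun x hx => ?_
    rw [← hB.vacuum x hx]
    simp only [sub_dotProduct, dotProduct_sub]
    ring
  · simpa using (hr.A i).covD hr.phi
  · exact ((hr.mom i).cross hr.phi).mono (by norm_num)

/-- A Lie-algebra valued function is controlled by its components along and transverse to the
Higgs field. -/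
lemma IsSymbol.of_components {a : ℝ} (ha : a ≠ 0) {φ f : Space → su2} {n : ℤ}
    (hφ : IsSymbol 0 φ) (hu : IsSymbol 1 (fun x => φ x ⬝ᵥ φ x - a ^ 2)) (hf : IsSymbol n f)
    (hpar : IsSymbol (n + 1) (fun x => φ x ⬝ᵥ f x))
    (hperp : IsSymbol (n + 1) (fun x => (φ x ⨯₃ f x) ⨯₃ φ x)) : IsSymbol (n + 1) f := by
  -- Use a² f = (φ · f) φ + (φ × f) × φ − (‖φ‖² − a²) f; in the last term the factor of order 1
  -- supplies the gain.
  have h := (((hpar.smul hφ).mono (m := n + 1) (by omega)).add hperp).sub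
    (add_comm (1 : ℤ) n ▸ hu.smul hf)
  refine (h.const_smul (a ^ 2)⁻¹).congr fun x _ => ?_
  have h2 : (φ x ⬝ᵥ f x) • φ x + (φ x ⨯₃ f x) ⨯₃ φ x = (φ x ⬝ᵥ φ x) • f x := by
    rw [cross_cross_eq_smul_sub_smul, dotProduct_comm (f x) (φ x)]
    abel
  rw [h2, sub_smul, sub_sub_cancel, smul_smul, inv_mul_cancel₀ (pow_ne_zero 2 ha), one_smul]

variable {e a : ℝ} {p : Fields}

/-- The four conclusions are the derivatives of the four decaying quantities along the curve. Decay
is assumed on all of S since the curve leaves p. -/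
lemma IsTangent.isSymbol {S : Set Fields} {v : Fields} {n : ℕ}
    (hv : IsTangent S p v) (hS : ∀ q ∈ S, DecaysToOrder e a n q) :
    IsSymbol n (fun x => p.phi x ⬝ᵥ v.phi x) ∧ IsSymbol n v.phiMom ∧
    (∀ i, IsSymbol n (fun x => covD e p.A i v.phi x + e • (v.A i x ⨯₃ p.phi x))) ∧
    ∀ i, IsSymbol n (fun x => p.mom i x ⨯₃ v.phi x + v.mom i x ⨯₃ p.phi x) := by
  obtain ⟨γ, C, c, h0, hγ, hC, hc, -, hd⟩ := hv
  have vphi : HasAsymptoticVelocity (fun t => (γ t).phi) v.phi :=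
    hasAsymptoticVelocity_of_hasVelocityOn (fun t => (hC t).phi) hc.phi fun n => (hd n).phi
  have vpd : ∀ i, HasAsymptoticVelocity (fun t => pd i (γ t).phi) (pd i v.phi) := fun i =>
    hasAsymptoticVelocity_pd_of_hasVelocityOn (fun t => (hC t).phi) hc.phi (fun n => (hd n).phi) i
  have vphiMom : HasAsymptoticVelocity (fun t => (γ t).phiMom) v.phiMom :=
    hasAsymptoticVelocity_of_hasVelocityOn (fun t => (hC t).phiMom) hc.phiMom
      fun n => (hd n).phiMom
  have vA : ∀ i, HasAsymptoticVelocity (fun t => (γ t).A i) (v.A i) := fun i =>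
    hasAsymptoticVelocity_of_hasVelocityOn (fun t => (hC t).A i) (hc.A i) fun n => (hd n).A i
  have vmom : ∀ i, HasAsymptoticVelocity (fun t => (γ t).mom i) (v.mom i) := fun i =>
    hasAsymptoticVelocity_of_hasVelocityOn (fun t => (hC t).mom i) (hc.mom i) fun n => (hd n).mom i
  have ephi : (γ 0).phi = p.phi := by rw [h0]
  refine ⟨?_, ?_, fun i => ?_, fun i => ?_⟩
  · have h := (vphi.bilinear vphi dotL ephi ephi).add (hasAsymptoticVelocity_const (-a ^ 2))
    have h' := (h.isSymbol fun t => (hS _ (hγ t)).vacuum.congr fun x _ => by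
      simp only [dotL_apply]; ring).const_smul (2⁻¹ : ℝ)
    refine h'.congr fun x _ => ?_
    simp only [dotL_apply, smul_eq_mul, add_zero]
    rw [dotProduct_comm (v.phi x)]
    ring
  · exact vphiMom.isSymbol fun t => (hS _ (hγ t)).phiMom
  · have h := (vpd i).add ((vA i).bilinear vphi (e • crossL) (by rw [h0]) ephi)
    refine (h.isSymbol fun t => (hS _ (hγ t)).covD i).congr fun x _ => ?_
    simp only [covD, _root_.smul_apply, crossL_apply]
    abel
  · have h := (vmom i).bilinear vphi crossL (by rw [h0]) ephi
    exact h.isSymbol fun t => (hS _ (hγ t)).mom i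

end Decay

/-! ### The inductive step: boosts gain one order -/

section Step

variable {e a : ℝ} {p : Fields} {ζ : Space → su2} {n : ℤ} {j : Fin 3}

lemma differentiable_coord_smul {f : Space → su2} (hf : ContDiff ℝ ∞ f) (j : Fin 3) (x : Space) :
    DifferentiableAt ℝ (fun y : Space => y j • f y) x :=
  DifferentiableAt.fun_smul (by fun_prop) (hf.differentiable (by simp) x)

lemma isSymbol_coord_smul {f : Space → su2} (hf : IsSymbol n f) (j : Fin 3) :
    IsSymbol (n - 1) (fun y : Space => y j • f y) :=
  ((isSymbol_coord j).smul hf).mono (by omega)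

lemma isSymbol_covD_coord_smul (hp : IsRegular p) {f : Space → su2} (hf : IsSymbol n f)
    (i j : Fin 3) : IsSymbol n (covD e p.A i (fun y => y j • f y)) :=
  ((hp.A i).covD (isSymbol_coord_smul hf j)).mono (by omega)

/-- The gauge term ζ × φ is orthogonal to φ. -/
lemma boost_phi_dot (h : IsSymbol n (fun x => p.phi x ⬝ᵥ
      (poincareVariation e a (boostAlong j) ζ p).phi x)) :
    IsSymbol n (fun x => x j • (p.phi x ⬝ᵥ p.phiMom x)) := by
  refine h.congr fun x _ => ?_
  rw [boost_variation_phi, dotProduct_add, dotProduct_smul, dotProduct_smul, dot_cross_self]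
  simp

/-- In δΠ everything but the potential term is already of order n: in D_l(x^j D^lφ) the derivative
pays for the factor x^j. -/
lemma boost_potential (hp : IsRegular p) (hζ : IsSymbol 0 ζ) (hn : DecaysToOrder e a n p)
    (h : IsSymbol n (poincareVariation e a (boostAlong j) ζ p).phiMom) :
    IsSymbol n (fun x => x j • (p.phi x ⬝ᵥ p.phi x - a ^ 2) • p.phi x) := by
  have h1 : IsSymbol n fun x => ∑ l, covD e p.A l (fun y => y j • covD e p.A l p.phi y) x :=
    IsSymbol.sum fun l _ => isSymbol_covD_coord_smul hp (hn.covD l) l j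
  have h2 := ((hζ.cross hn.phiMom).mono (m := n) (by omega)).const_smul e
  refine (((h1.add h2).sub h).const_smul (4⁻¹ : ℝ)).congr fun x _ => ?_
  rw [boost_variation_phiMom]
  module

/-- The D_iζ terms from δφ and δA_i cancel, so δ(D_iφ) = D_i(x^j Π) + e ζ × D_iφ + e x^j π_i × φ. -/
lemma boost_mom_cross (hp : IsRegular p) (he : e ≠ 0) (hζ : IsSymbol 0 ζ) (sζ : ContDiff ℝ ∞ ζ)
    (hn : DecaysToOrder e a n p) (i : Fin 3)
    (h : IsSymbol n (fun x => covD e p.A i (poincareVariation e a (boostAlong j) ζ p).phi x +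
      e • ((poincareVariation e a (boostAlong j) ζ p).A i x ⨯₃ p.phi x))) :
    IsSymbol n (fun x => x j • (p.mom i x ⨯₃ p.phi x)) := by
  have h1 := isSymbol_covD_coord_smul (e := e) hp hn.phiMom i j
  have h2 := ((hζ.cross (hn.covD i)).mono (m := n) (by omega)).const_smul e
  refine (((h.sub h1).sub h2).const_smul e⁻¹).congr fun x _ => ?_
  have dζ : DifferentiableAt ℝ ζ x := sζ.differentiable (by simp) x
  have dφ : DifferentiableAt ℝ p.phi x := hp.smooth_phi.differentiable (by simp) x
  have hφ : (poincareVariation e a (boostAlong j) ζ p).phi =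
    fun y => y j • p.phiMom y + e • (ζ y ⨯₃ p.phi y) := funext fun y => boost_variation_phi j y
  rw [hφ, boost_variation_A, covD_add (differentiable_coord_smul hp.smooth_phiMom j x)
    ((differentiableAt_cross dζ dφ).fun_const_smul e),
    covD_const_smul (differentiableAt_cross dζ dφ), covD_cross dζ dφ]
  simp only [map_sub, map_smul, LinearMap.sub_apply, LinearMap.smul_apply, smul_add, smul_sub,
    smul_smul, inv_mul_cancel₀ he, one_smul]
  rw [← mul_assoc, inv_mul_cancel₀ he, one_mul]
  abel

/-- Cross the Gauss constraint with φ and write D_iπ^i × φ = D_i(π^i × φ) − π^i × D_iφ. -/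
lemma gauss_phiMom (hp : IsRegular p) (he : e ≠ 0) (hg : ∀ x, gauss e p x = 0)
    (hn : ∀ i, IsSymbol n (covD e p.A i p.phi))
    (hmom : ∀ i, IsSymbol (n + 1) (fun x => p.mom i x ⨯₃ p.phi x)) :
    IsSymbol (n + 1) (fun x => (p.phi x ⨯₃ p.phiMom x) ⨯₃ p.phi x) := by
  have h1 : IsSymbol (n + 1) fun x => ∑ i,
      (covD e p.A i (fun y => p.mom i y ⨯₃ p.phi y) x - p.mom i x ⨯₃ covD e p.A i p.phi x) :=
    IsSymbol.sum fun i _ => (((hp.A i).covD (hmom i)).mono (by omega)).sub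
      (((hp.mom i).cross (hn i)).mono (by omega))
  refine (h1.const_smul (-e⁻¹)).congr fun x _ => ?_
  have h2 := congrArg (fun w => w ⨯₃ p.phi x) (hg x)
  simp only [gauss, map_add, LinearMap.add_apply, map_sum, LinearMap.sum_apply, map_smul,
    LinearMap.smul_apply, map_zero, LinearMap.zero_apply] at h2
  have h3 : ∀ i, covD e p.A i (fun y => p.mom i y ⨯₃ p.phi y) x
      - p.mom i x ⨯₃ covD e p.A i p.phi x = covD e p.A i (p.mom i) x ⨯₃ p.phi x := fun i => by
    rw [covD_cross ((hp.smooth_mom i).differentiable (by simp) x)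
      (hp.smooth_phi.differentiable (by simp) x), add_sub_cancel_left]
  simp only [h3]
  rw [eq_neg_of_add_eq_zero_left h2, smul_neg, neg_smul, neg_neg, smul_smul, inv_mul_cancel₀ he,
    one_smul]

/-- F_ik × φ is a commutator of covariant derivatives of φ, so it inherits the decay of Dφ, unlike
F_ik itself. -/
lemma isSymbol_curvature_cross (hp : IsRegular p) (he : e ≠ 0)
    (hn : ∀ i, IsSymbol n (covD e p.A i p.phi)) (i k : Fin 3) :
    IsSymbol (n + 1) (fun x => curvature e p.A i k x ⨯₃ p.phi x) := by
  refine ((((hp.A i).covD (e := e) (hn k)).sub ((hp.A k).covD (e := e) (hn i))).const_smul e⁻¹).congr fun x _ => ?_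
  rw [← curvature_cross hp.smooth_A hp.smooth_phi, smul_smul, inv_mul_cancel₀ he, one_smul]

/-- In δ(π^i × φ) the curvature enters as D_k(x^j F_ki) × φ = D_k(x^j F_ki × φ) − x^j F_ki × D_kφ,
of order n. The gauge terms combine by Jacobi to e ζ × (π^i × φ). What is left is −e x^j (φ × D_iφ)
× φ. -/
lemma boost_covD_perp (hp : IsRegular p) (he : e ≠ 0) (hζ : IsSymbol 0 ζ)
    (hn : DecaysToOrder e a n p) (i : Fin 3)
    (h : IsSymbol n (fun x => p.mom i x ⨯₃ (poincareVariation e a (boostAlong j) ζ p).phi x +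
      (poincareVariation e a (boostAlong j) ζ p).mom i x ⨯₃ p.phi x)) :
    IsSymbol n (fun x => x j • ((p.phi x ⨯₃ covD e p.A i p.phi x) ⨯₃ p.phi x)) := by
  have h1 : IsSymbol n fun x => ∑ k,
      (covD e p.A k (fun y => y j • (curvature e p.A k i y ⨯₃ p.phi y)) x
        - x j • (curvature e p.A k i x ⨯₃ covD e p.A k p.phi x)) :=
    IsSymbol.sum fun k _ =>
      ((isSymbol_covD_coord_smul hp (isSymbol_curvature_cross hp he hn.covD k i) k j).mono
        (by omega)).sub ((isSymbol_coord_smul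
          ((isSymbol_curvature hp.A k i).cross (hn.covD k)) j).mono (by omega))
  have h2 : IsSymbol n fun x => x j • (p.mom i x ⨯₃ p.phiMom x) :=
    (isSymbol_coord_smul ((hp.mom i).cross hn.phiMom) j).mono (by omega)
  have h3 := ((hζ.cross (hn.mom i)).mono (m := n) (by omega)).const_smul e
  refine ((((h1.add h2).add h3).sub h).const_smul e⁻¹).congr fun x _ => ?_
  have dφ : DifferentiableAt ℝ p.phi x := hp.smooth_phi.differentiable (by simp) x
  have h4 : ∀ k, covD e p.A k (fun y => y j • (curvature e p.A k i y ⨯₃ p.phi y)) x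
      - x j • (curvature e p.A k i x ⨯₃ covD e p.A k p.phi x)
      = covD e p.A k (fun y => y j • curvature e p.A k i y) x ⨯₃ p.phi x := fun k => by
    have h5 := covD_cross (e := e) (A := p.A)
      (differentiable_coord_smul (contDiff_curvature (e := e) hp.smooth_A k i) j x) dφ k
    simp only [map_smul, LinearMap.smul_apply] at h5
    rw [h5, add_sub_cancel_left]
  simp only [h4]
  rw [boost_variation_mom, boost_variation_phi]
  simp only [map_add, map_sub, map_smul, map_sum, LinearMap.add_apply, LinearMap.sub_apply,
    LinearMap.smul_apply, LinearMap.sum_apply]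
  rw [leibniz_cross (ζ x) (p.mom i x) (p.phi x)]
  match_scalars <;> field_simp <;> ring

/-- If every state of a Poincaré invariant set decays to order `n`, then it decays to order
`n + 1`. -/
lemma DecaysToOrder.succ {S : Set Fields} (he : e ≠ 0) (ha : a ≠ 0)
    (hS : S ⊆ constraintSurface e a) (hinv : PoincareInvariant e a S) {n : ℕ} (hn1 : 1 ≤ n)
    (hn : ∀ q ∈ S, DecaysToOrder e a n q) (hp : p ∈ S) : DecaysToOrder e a (n + 1) p := by
  have hr : IsRegular p := by
    obtain ⟨⟨C, hC, -⟩, -⟩ := hS hp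
    exact hC.isRegular
  have hg := (hS hp).2
  have hd := hn p hp
  have hu : IsSymbol 1 (fun x => p.phi x ⬝ᵥ p.phi x - a ^ 2) := hd.vacuum.mono (by omega)
  choose ζ z hζ using fun j => hinv p hp (boostAlong j)
  have sζ : ∀ j, ContDiff ℝ ∞ (ζ j) := fun j => by
    obtain ⟨z, hz⟩ := z j
    exact hz.smooth
  have dζ : ∀ j, IsSymbol 0 (ζ j) := fun j => by
    obtain ⟨z, hz⟩ := z j
    exact hz.hasAsymptotics.isSymbol
  have key := fun j => (hζ j).isSymbol hn
  have hpar : IsSymbol (n + 1) fun x => p.phi x ⬝ᵥ p.phiMom x :=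
    IsSymbol.of_coord_smul fun j => boost_phi_dot (key j).1
  have hpot : IsSymbol (n + 1) fun x => (p.phi x ⬝ᵥ p.phi x - a ^ 2) • p.phi x :=
    IsSymbol.of_coord_smul fun j => boost_potential hr (dζ j) hd (key j).2.1
  have hvac : IsSymbol (n + 1) fun x => p.phi x ⬝ᵥ p.phi x - a ^ 2 := by
    -- With u = ‖φ‖² − a²: a² u = (u φ) · φ − u², and u² gains an order because n ≥ 1.
    have h1 := (hpot.dot hr.phi).mono (m := n + 1) (by omega)
    have h2 := (hu.smul hd.vacuum).mono (m := n + 1) (by omega)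
    refine ((h1.sub h2).const_smul (a ^ 2)⁻¹).congr fun x _ => ?_
    simp only [smul_dotProduct, smul_eq_mul]
    field_simp
    ring
  have hmom : ∀ i, IsSymbol (n + 1) fun x => p.mom i x ⨯₃ p.phi x := fun i =>
    IsSymbol.of_coord_smul fun j =>
      boost_mom_cross hr he (dζ j) (sζ j) hd i ((key j).2.2.1 i)
  refine ⟨hvac, fun i => ?_, ?_, hmom⟩
  · refine IsSymbol.of_components ha hr.phi hu (hd.covD i) ?_ <|
      IsSymbol.of_coord_smul fun j => boost_covD_perp hr he (dζ j) hd i ((key j).2.2.2 i)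
    -- The longitudinal part: φ · D_iφ = ½ ∂_i(‖φ‖² − a²).
    refine (((hvac.pd i).mono (m := n + 1) (by omega)).const_smul (2⁻¹ : ℝ)).congr fun x _ => ?_
    have dφ : DifferentiableAt ℝ p.phi x := hr.smooth_phi.differentiable (by simp) x
    have h1 : pd i (fun x => p.phi x ⬝ᵥ p.phi x - a ^ 2) x
        = pd i (fun x => p.phi x ⬝ᵥ p.phi x) x := by
      simp only [pd, fderiv_sub_const]
    rw [h1, pd_dot dφ dφ, dotProduct_comm (pd i p.phi x), YMH.covD, dotProduct_add,
      dotProduct_smul, dot_cross_self, smul_zero, add_zero, smul_eq_mul]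
    ring
  · exact IsSymbol.of_components ha hr.phi hu hd.phiMom hpar (gauss_phiMom hr he hg hd.covD hmom)

lemma PoincareInvariant.decaysToOrder {S : Set Fields} (he : e ≠ 0) (ha : a ≠ 0)
    (hS : S ⊆ constraintSurface e a) (hinv : PoincareInvariant e a S) (n : ℕ) :
    ∀ p ∈ S, DecaysToOrder e a (n + 1) p := by
  induction n with
  | zero => exact fun p hp => by simpa using decaysToOrder_one (hS hp)
  | succ n ih =>
    intro p hp
    have := DecaysToOrder.succ (n := n + 1) he ha hS hinv (by omega)
      (by simpa using ih) hp
    simpa using this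

end Step

/-! ### From decay to every order to the stated form -/

section Conclusion

lemma vanishesToAllOrders_of_isSymbol {f : Space → su2} (sf : ContDiff ℝ ∞ f)
    (hf : ∀ n : ℕ, IsSymbol n f) : VanishesToAllOrders f where
  smooth := sf
  smooth_coeff _ := contDiffOn_const
  homogeneous _ _ _ _ _ := by simp
  remainder N k := by
    have := (hf N).bound k
    simpa only [Finset.sum_const_zero, sub_zero, ← zpow_natCast, ← zpow_neg, Nat.cast_add]
      using this

/-- Meant for h = ‖φ‖⁻², which may be singular where φ vanishes; hence only boundedness near
infinity is asked of it. The spare order in n + 1 turns O into o. -/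
lemma isFastFalloff_of_isSymbol {f g : Space → su2} {h : Space → ℝ}
    (hg : ∀ n : ℕ, IsSymbol (n + 1) g) (hh : h =O[cobounded Space] (fun _ => (1 : ℝ)))
    (hf : ∀ᶠ x in cobounded Space, f x = h x • g x) : IsFastFalloff f := by
  intro n
  have h1 := (hh.smul (hg n).isBigO).congr' (hf.mono fun x hx => hx.symm) EventuallyEq.rfl
  refine h1.trans_isLittleO ?_
  have h2 : (fun x : Space => ‖x‖⁻¹) =o[cobounded Space] (fun _ => (1 : ℝ)) := by
    rw [isLittleO_one_iff]
    exact tendsto_inv_atTop_zero.comp tendsto_norm_cobounded_atTop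
  refine (h2.mul_isBigO (isBigO_refl (fun x : Space => (‖x‖ ^ n)⁻¹) _)).congr' ?_ ?_
  · filter_upwards [eventually_ne_zero_cobounded] with x hx
    rw [smul_eq_mul, one_mul, neg_add, add_comm, zpow_add₀ (norm_ne_zero_iff.2 hx), zpow_neg_one,
      zpow_neg, zpow_natCast]
  · exact Eventually.of_forall fun x => one_mul _

end Conclusion

end YMH

theorem mainTheorem2 (e a : ℝ) (he : e ≠ 0) (ha : 0 < a) (S : Set YMH.Fields)
    (hS : S ⊆ YMH.constraintSurface e a) (hinv : YMH.PoincareInvariant e a S)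
    (p : YMH.Fields) (hp : p ∈ S) :
    (∀ i, YMH.VanishesToAllOrders (YMH.covD e p.A i p.phi)) ∧
    YMH.VanishesToAllOrders p.phiMom ∧
    (∀ i, YMH.IsFastFalloff (fun x => p.A i x -
      (((p.A i x ⬝ᵥ p.phi x) / (p.phi x ⬝ᵥ p.phi x)) • p.phi x
        - (e * (p.phi x ⬝ᵥ p.phi x))⁻¹ • (p.phi x ⨯₃ YMH.pd i p.phi x)))) ∧
    (∀ i, YMH.IsFastFalloff (fun x => p.mom i x -
      ((p.mom i x ⬝ᵥ p.phi x) / (p.phi x ⬝ᵥ p.phi x)) • p.phi x)) := by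
  have hd := fun n => hinv.decaysToOrder he ha.ne' hS n p hp
  have hr : YMH.IsRegular p := by
    obtain ⟨⟨C, hC, -⟩, -⟩ := hS hp
    exact hC.isRegular
  have hlim : Tendsto (fun x => p.phi x ⬝ᵥ p.phi x) (cobounded YMH.Space) (𝓝 (a ^ 2)) := by
    have h1 : Tendsto (fun x => p.phi x ⬝ᵥ p.phi x - a ^ 2) (cobounded YMH.Space) (𝓝 0) := by
      refine (hd 0).vacuum.isBigO.trans_tendsto ?_
      simpa [Function.comp_def] using
        tendsto_inv_atTop_zero.comp (tendsto_norm_cobounded_atTop (E := YMH.Space))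
    have h2 := h1.add_const (a ^ 2)
    rw [zero_add] at h2
    exact h2.congr fun x => sub_add_cancel _ _
  have ha2 : a ^ 2 ≠ 0 := pow_ne_zero 2 ha.ne'
  have hne : ∀ᶠ x in cobounded YMH.Space, p.phi x ⬝ᵥ p.phi x ≠ 0 := hlim.eventually_ne ha2
  have hinvO : (fun x => (p.phi x ⬝ᵥ p.phi x)⁻¹) =O[cobounded YMH.Space] (fun _ => (1 : ℝ)) :=
    (hlim.inv₀ ha2).isBigO_one ℝ
  refine ⟨fun i => YMH.vanishesToAllOrders_of_isSymbol
      (YMH.contDiff_covD (hr.smooth_A i) hr.smooth_phi) fun n => ((hd n).covD i).mono (by omega),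
    YMH.vanishesToAllOrders_of_isSymbol hr.smooth_phiMom fun n => (hd n).phiMom.mono (by omega),
    fun i => ?_, fun i => ?_⟩
  -- The error term equals ‖φ‖⁻² e⁻¹ φ × D_iφ, by expanding φ × (A_i × φ).
  · refine YMH.isFastFalloff_of_isSymbol
      (fun n => ((hr.phi.cross ((hd n).covD i)).mono (m := n + 1) (by omega)).const_smul e⁻¹)
      hinvO ?_
    filter_upwards [hne] with x hx
    have h1 : p.phi x ⨯₃ (p.A i x ⨯₃ p.phi x)
        = (p.phi x ⬝ᵥ p.phi x) • p.A i x - (p.A i x ⬝ᵥ p.phi x) • p.phi x := by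
      rw [cross_cross_eq_smul_sub_smul']
    rw [YMH.covD, map_add, map_smul, h1, div_eq_mul_inv]
    match_scalars <;> field_simp
  -- Here the error term is ‖φ‖⁻² φ × (π^i × φ).
  · refine YMH.isFastFalloff_of_isSymbol
      (fun n => ((hr.phi.cross ((hd n).mom i)).mono (m := n + 1) (by omega))) hinvO ?_
    filter_upwards [hne] with x hx
    rw [cross_cross_eq_smul_sub_smul']
    match_scalars <;> field_simp
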